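/- Let $G$ be a finite Abelian group whose order $|G|$ is square-free, regarded as a $G$-space under the action of $G$ on itself by translations $(g,x)\mapsto gx$. Then every kaleidoscopical subset $K\subset G$ is splittable. Here a subset $K$ of a $G$-space $X$ is called kaleidoscopical if there is a surjective coloring $\chi:X\to C$ such that for every $g\in G$ the restriction $\chi|_{gK}:gK\to C$ is a bijection. An equivalence relation $E$ on $X$ is $G$-invariant if $(x,y)\in E$ implies $(gx,gy)\in E$ for all $g\in G$; write $[x]_E$ for the class of $x$ and $[K]_E=\bigcup_{x\in K}[x]_E$. For equivalence relations $E\subset F$ on $X$, the set $K$ is $F/E$-parallel if $[K]_E\cap[x]_F=[x]_F$ for all $x\in K$, and $F/E$-orthogonal if $[K]_E\cap[x]_F=[x]_E$ for all $x\in K$. The set $K$ is splittable if for some integer $m\ge 0$ there is an increasing (not necessarily strictly) sequence of $G$-invariant equivalence relations $$\{(x,x):x\in X\}=E_0\subset E_1\subset\dots\subset E_m=X\times X$$ such that for every $i<m$ the set $K$ is $E_{i+1}/E_i$-parallel or $E_{i+1}/E_i$-orthogonal. -/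

import Mathlib

universe u

/-- A coloring (a surjection `χ : X → C`) is kaleidoscopical for a family `𝓕` of subsets of `X` if
its restriction to every member of `𝓕` is a bijection onto the set `C` of all colors. -/
def IsKaleidoscopicalColoring {X C : Type*} (𝓕 : Set (Set X)) (χ : X → C) : Prop :=
  Function.Surjective χ ∧ ∀ F ∈ 𝓕, Set.BijOn χ F Set.univ

/-- The hypergraph `(X, 𝓕)` is kaleidoscopical if it has a kaleidoscopical coloring. A set of
colors is the image of `X`, so color sets in the universe of `X` give all of them. -/
def IsKaleidoscopicalHypergraph {X : Type u} (𝓕 : Set (Set X)) : Prop :=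
  ∃ (κ : Type u) (χ : X → κ), IsKaleidoscopicalColoring 𝓕 χ

/-- The family `G[A] = {gA : g ∈ G}` of translates of `A`. -/
def translates (G : Type*) {X : Type*} [Group G] [MulAction G X] (A : Set X) : Set (Set X) :=
  Set.range fun g : G => (fun x => g • x) '' A

/-- `A` is a kaleidoscopical subset (configuration) of the `G`-space `X`. -/
def IsKaleidoscopical (G : Type*) {X : Type*} [Group G] [MulAction G X] (A : Set X) : Prop :=
  IsKaleidoscopicalHypergraph (translates G A)

/-- The equivalence class `[x]_E`. -/
def eqClass {X : Type*} (E : Setoid X) (x : X) : Set X := {y | E x y}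

/-- The saturation `[K]_E`, the union of the classes of the points of `K`. -/
def saturation {X : Type*} (E : Setoid X) (K : Set X) : Set X := ⋃ x ∈ K, eqClass E x

/-- `K` is `F/E`-parallel. -/
def IsParallel {X : Type*} (F E : Setoid X) (K : Set X) : Prop :=
  ∀ x ∈ K, saturation E K ∩ eqClass F x = eqClass F x

/-- `K` is `F/E`-orthogonal. -/
def IsOrthogonal {X : Type*} (F E : Setoid X) (K : Set X) : Prop :=
  ∀ x ∈ K, saturation E K ∩ eqClass F x = eqClass E x

/-- `E` is a `G`-invariant equivalence relation (an imprimitivity) on `X`. -/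
def IsInvariantSetoid (G : Type*) {X : Type*} [Group G] [MulAction G X] (E : Setoid X) : Prop :=
  ∀ (g : G) (x y : X), E x y → E (g • x) (g • y)

/-- `K` is splittable: there is a finite increasing chain of `G`-invariant equivalence relations
from the diagonal `⊥` to `⊤ = X × X` such that for each two consecutive terms `E ⊆ F` the set `K`
is `F/E`-parallel or `F/E`-orthogonal. -/
def IsSplittable (G : Type*) {X : Type*} [Group G] [MulAction G X] (K : Set X) : Prop :=
  ∃ (m : ℕ) (E : Fin (m + 1) → Setoid X),
    E 0 = ⊥ ∧ E (Fin.last m) = ⊤ ∧ Monotone E ∧ (∀ i, IsInvariantSetoid G (E i)) ∧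
      ∀ i : Fin m, IsParallel (E i.succ) (E i.castSucc) K ∨ IsOrthogonal (E i.succ) (E i.castSucc) K

/-! A color class `A` gives a factorization `G = K⁻¹A`, so `|K||A| = |G|`, and square-freeness makes
`|K|` and `|A|` coprime. A factor may be raised to any power coprime to its size. Raising `K⁻¹` to
the power `|A|` shows that `x ↦ x^|A|` is injective on `K`; raising `A` to the power `|K|` gives
elements killed by this map, so `K` meets all its fibers. Thus `K` is a transversal of the fibers:
orthogonal below, parallel above. -/

/-- In a finite factorization `G = K * A` of a commutative group, the factor `K` may be replaced by
its image under the `p`-th power map, for every prime `p` not dividing `|K|`. -/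
theorem bijective_pow_mul_of_prime {G ι J : Type*} [CommGroup G] [Finite G] [Fintype ι] [Fintype J]
    {κ : ι → G} {α : J → G} (h : Function.Bijective fun x : ι × J => κ x.1 * α x.2)
    {p : ℕ} (hp : p.Prime) (hpι : ¬ p ∣ Fintype.card ι) :
    Function.Bijective fun x : ι × J => κ x.1 ^ p * α x.2 := by
  classical
  have : Fintype G := Fintype.ofFinite G
  have : Fact p.Prime := ⟨hp⟩
  rw [Fintype.bijective_iff_surjective_and_card]
  refine ⟨fun g => ?_, Fintype.card_of_bijective h⟩
  by_contra hg
  push Not at hg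
  -- In `𝔽_p[G]`, Frobenius turns `S ^ p` into the sum of the p-th powers, while `S ^ p * T =
  -- |ι|^(p-1) • U` has no zero coefficient, so no `g` is missed.
  let e : G →* MonoidAlgebra (ZMod p) G := MonoidAlgebra.of (ZMod p) G
  have : CharP (MonoidAlgebra (ZMod p) G) p :=
    charP_of_injective_algebraMap (algebraMap (ZMod p) (MonoidAlgebra (ZMod p) G)).injective p
  let S := ∑ i, e (κ i)
  let T := ∑ j, e (α j)
  let U := ∑ g, e g
  have hST : S * T = U := by
    simp only [S, T, U, Finset.sum_mul_sum, ← map_mul]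
    rw [← Fintype.sum_prod_type']
    exact Fintype.sum_bijective _ h _ _ fun _ => rfl
  have hSU : S * U = (Fintype.card ι : ZMod p) • U := by
    have (g : G) : e g * U = U := by
      simp only [U, Finset.mul_sum, ← map_mul]
      exact Fintype.sum_bijective _ (Group.mulLeft_bijective g) _ _ fun _ => rfl
    simp only [S, Finset.sum_mul, this, Finset.sum_const, Finset.card_univ]
    rw [Nat.cast_smul_eq_nsmul]
  have hpow (n : ℕ) : S ^ n * U = (Fintype.card ι : ZMod p) ^ n • U := by
    induction n with
    | zero => simp
    | succ n ih => rw [pow_succ, mul_assoc, hSU, mul_smul_comm, ih, smul_smul, ← pow_succ']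
  have hSp : S ^ p * T = (Fintype.card ι : ZMod p) ^ (p - 1) • U := by
    rw [← hpow, ← hST, ← mul_assoc, ← pow_succ, Nat.sub_add_cancel hp.one_le]
  have hSpT : S ^ p * T = ∑ x : ι × J, e (κ x.1 ^ p * α x.2) := by
    simp only [S, T, sum_pow_char, Finset.sum_mul_sum, ← map_mul, ← map_pow]
    rw [← Fintype.sum_prod_type']
  let ev : MonoidAlgebra (ZMod p) G →+ ZMod p :=
    { toFun := fun f => f.coeff g, map_zero' := rfl, map_add' := fun _ _ => rfl }
  have hev (x : G) : ev (e x) = if x = g then 1 else 0 := by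
    change (MonoidAlgebra.single x (1 : ZMod p)).coeff g = _
    simp [Finsupp.single_apply]
  have hl : ev (S ^ p * T) = 0 := by
    rw [hSpT, map_sum]
    exact Finset.sum_eq_zero fun x _ => by rw [hev, if_neg (hg x)]
  have hU : ev U = 1 := by simp [U, hev]
  have hr : ev (S ^ p * T) = (Fintype.card ι : ZMod p) ^ (p - 1) := by
    rw [hSp]
    change (Fintype.card ι : ZMod p) ^ (p - 1) • ev U = _
    rw [hU, smul_eq_mul, mul_one]
  refine pow_ne_zero (p - 1) ?_ (hr.symm.trans hl)
  rwa [Ne, ZMod.natCast_eq_zero_iff]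

/-- In a finite factorization `G = K * A` of a commutative group, the factor `K` may be replaced by
its image under the `n`-th power map, for every `n` coprime to `|K|`. -/
theorem bijective_pow_mul_of_coprime {G ι J : Type*} [CommGroup G] [Finite G] [Fintype ι]
    [Fintype J] {κ : ι → G} {α : J → G} (h : Function.Bijective fun x : ι × J => κ x.1 * α x.2)
    {n : ℕ} (hn : n ≠ 0) (hnι : n.Coprime (Fintype.card ι)) :
    Function.Bijective fun x : ι × J => κ x.1 ^ n * α x.2 := by
  induction n using induction_on_primes with
  | zero => exact absurd rfl hn
  | one => simpa using h
  | prime_mul p a hp ih =>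
    have ha := ih (right_ne_zero_of_mul hn) (Nat.Coprime.coprime_mul_left hnι)
    have := bijective_pow_mul_of_prime (κ := fun i => κ i ^ a) ha hp
      (hp.coprime_iff_not_dvd.1 (Nat.Coprime.coprime_mul_right hnι))
    simpa only [← pow_mul, mul_comm a p] using this

/-- A kaleidoscopical subset of a group is, up to inversion, a factor of the group. -/
theorem IsKaleidoscopical.exists_bijective_mul {G : Type*} [CommGroup G] {K : Set G}
    (hK : IsKaleidoscopical G K) :
    ∃ A : Set G, Function.Bijective fun x : K × A => (x.1 : G)⁻¹ * (x.2 : G) := by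
  obtain ⟨C, χ, -, hχ⟩ := hK
  have hχ (g : G) := hχ _ ⟨g, rfl⟩
  refine ⟨{x | χ x = χ 1}, ?_, fun g => ?_⟩
  · rintro ⟨⟨k, hk⟩, ⟨a, ha⟩⟩ ⟨⟨l, hl⟩, ⟨b, hb⟩⟩ (hab : k⁻¹ * a = l⁻¹ * b)
    -- Both `a` and `b` lie in the translate `k⁻¹aK = l⁻¹bK`, on which `χ` is injective.
    have hae : a = b := (hχ (k⁻¹ * a)).injOn ⟨k, hk, by simp [mul_comm]⟩
      ⟨l, hl, by simp [hab, mul_comm]⟩ (ha.trans hb.symm)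
    subst hae
    simpa using hab
  · obtain ⟨_, ⟨k, hk, rfl⟩, ha⟩ := (hχ g).surjOn (Set.mem_univ (χ 1))
    exact ⟨⟨⟨k, hk⟩, ⟨_, ha⟩⟩, by simp [mul_comm]⟩

/-- A transversal of the classes of an invariant equivalence relation is splittable. -/
theorem IsSplittable.of_transversal {G X : Type*} [Group G] [MulAction G X] {K : Set X}
    (E : Setoid X) (hE : IsInvariantSetoid G E) (hinj : ∀ x ∈ K, ∀ y ∈ K, E x y → x = y)
    (hsurj : ∀ y, ∃ x ∈ K, E x y) : IsSplittable G K := by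
  refine ⟨2, ![⊥, E, ⊤], rfl, rfl, ?_, ?_, ?_⟩
  · rw [Fin.monotone_iff_le_succ]
    intro i
    fin_cases i
    · exact bot_le
    · exact le_top
  · intro i
    fin_cases i
    · rintro g x y (rfl : x = y)
      rfl
    · exact hE
    · exact fun _ _ _ _ => trivial
  · intro i
    fin_cases i
    · right
      intro x hx
      ext y
      constructor
      · rintro ⟨hy, hxy⟩
        obtain ⟨z, hz, rfl : z = y⟩ := Set.mem_iUnion₂.1 hy
        exact hinj x hx z hz hxy
      · rintro (rfl : x = y)
        exact ⟨Set.mem_iUnion₂.2 ⟨x, hx, rfl⟩, E.refl x⟩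
    · left
      intro x _
      refine Set.inter_eq_right.2 fun y _ => ?_
      obtain ⟨z, hz, hzy⟩ := hsurj y
      exact Set.mem_iUnion₂.2 ⟨z, hz, hzy⟩

theorem mainTheorem11 {G : Type*} [CommGroup G] [Finite G] (hG : Squarefree (Nat.card G))
    (K : Set G) (hK : IsKaleidoscopical G K) : IsSplittable G K := by
  classical
  obtain ⟨A, hA⟩ := hK.exists_bijective_mul
  have : Fintype K := Fintype.ofFinite K
  have : Fintype A := Fintype.ofFinite A
  have hcard : Fintype.card K * Fintype.card A = Nat.card G := by
    rw [← Nat.card_congr (Equiv.ofBijective _ hA), Nat.card_prod, Nat.card_eq_fintype_card,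
      Nat.card_eq_fintype_card]
  have hne : Fintype.card K * Fintype.card A ≠ 0 := hcard ▸ Nat.card_pos.ne'
  have hcop : (Fintype.card K).Coprime (Fintype.card A) :=
    Nat.coprime_of_squarefree_mul (hcard ▸ hG)
  have hKpow := bijective_pow_mul_of_coprime (κ := fun k : K => (k : G)⁻¹)
    (α := fun a : A => (a : G)) hA (right_ne_zero_of_mul hne) hcop.symm
  have hA' : Function.Bijective fun x : A × K => (x.1 : G) * (x.2 : G)⁻¹ := by
    simpa only [Function.comp_def, Equiv.prodComm_apply, Prod.fst_swap, Prod.snd_swap, mul_comm]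
      using hA.comp (Equiv.prodComm A K).bijective
  have hApow := bijective_pow_mul_of_coprime (κ := fun a : A => (a : G))
    (α := fun k : K => (k : G)⁻¹) hA' (left_ne_zero_of_mul hne) hcop
  obtain ⟨a⟩ : Nonempty A := Fintype.card_pos_iff.1 (Nat.pos_of_ne_zero (right_ne_zero_of_mul hne))
  refine IsSplittable.of_transversal (Setoid.ker fun x : G => x ^ Fintype.card A) ?_ ?_ ?_
  · intro g x y (hxy : x ^ _ = y ^ _)
    change (g * x) ^ _ = (g * y) ^ _
    rw [mul_pow, mul_pow, hxy]
  · intro x hx y hy (hxy : x ^ _ = y ^ _)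
    have := hKpow.injective (a₁ := (⟨x, hx⟩, a)) (a₂ := (⟨y, hy⟩, a)) 
      (by simp only [inv_pow, hxy])
    simpa using this
  · intro y
    -- The inverse of `y` is factored because `K` enters the factorization inverted: `y⁻¹ = b^|K|
    -- k⁻¹`.
    obtain ⟨⟨b, k⟩, hbk⟩ := hApow.surjective y⁻¹
    refine ⟨k, k.2, ?_⟩
    have hb : ((b : G) ^ Fintype.card K) ^ Fintype.card A = 1 := by
      rw [← pow_mul, hcard, pow_card_eq_one']
    have := congrArg (· ^ Fintype.card A) hbk
    simp only [mul_pow, hb, one_mul, inv_pow, inv_inj] at this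
    exact this
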